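/- Setting. Let $\mathcal G$ be a connected undirected graph on $N$ agents and let $K=K^\top\in\mathbb R^{N\times N}$ be its weight matrix, i.e. for $i\ne j$, $K_{ij}=-k_{ij}$ with $k_{ij}>0$ if $i,j$ are adjacent and $k_{ij}=0$ otherwise, $\mathbf 1^\top K=0$ and $\rho(K)<1$. Let $f_i(x)=\tfrac12x^\top Q_ix+c_i^\top x$ on $\mathbb R^n$ with $Q_i\succeq0$, $Q=\mathrm{diag}(Q_1,\dots,Q_N)$. Write $K$ also for $K\otimes I_n$ and put $$\bar A=\begin{bmatrix}I-K-\alpha Q&-K\\K&I\end{bmatrix},\qquad \bar B=\begin{bmatrix}B\\B\end{bmatrix},$$ where $B\in\mathbb R^{nN\times n}$ has the block $I_n$ at the attacked agent $v_a$ and zeros elsewhere. The step size $\alpha>0$ is such that the attack-free iteration $\bar x[k+1]=\bar A\bar x[k]+\bar c$, $\bar x=(x,z)$, $\bar c=(-\alpha c,0)$, solves the problem: there is a minimizer $x^*$ of $\sum_if_i$ such that $x_i[k]\to x^*$ for all $i$ and all initial states. Let $\bar C_p\bar x=(x_i-x_{i+1})_{1\le i<N}$ and $\bar C_m\bar x=\big((I-W)x_{v_m},\,Wz_{v_m}\big)$,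 where $v_m$ is the monitored agent and $W=\mathrm{diag}(w_1,\dots,w_n)$, $w_s\in[0,1]$. Let $d=\delta_m-\delta_p$, where $\delta_m,\delta_p$ are the relative degrees ($1+\min\{j\ge0: C\bar A^j\bar B\neq0\}$) of $(\bar A,\bar B,\bar C_m,0)$ and $(\bar A,\bar B,\bar C_p,0)$. Let $(\tilde A,\tilde B,\tilde C_p,\tilde C_m)$ be the system with state $\tilde x[k]=(\bar x[k],\bar x[k-1],\dots,\bar x[k-d])$, input $a[k]\in\mathbb R^n$, delayed performance output $\tilde C_p\tilde x[k]=\bar C_p\bar x[k-d]$ and detection output $\tilde C_m\tilde x[k]=\bar C_m\bar x[k]$. For an attack sequence $a$ let $\tilde x_a[0]=0$, $\tilde x_a[k+1]=\tilde A\tilde x_a[k]+\tilde Ba[k]$, $\tilde y_{p,a}=\tilde C_p\tilde x_a$, $\tilde y_{m,a}=\tilde C_m\tilde x_a$, and $\|y\|^2_{\ell_2,[1,L]}=\sum_{k=1}^L\|y[k]\|^2$. For $\epsilon>0$ the modified security metric is $$\tilde\gamma(v_m,v_a,K)=\sup_{L\ge1}\ \sup_{a\in\ell_{2e}}\Big\{\|\tilde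 y_{p,a}\|^2_{\ell_2,[1,L]}\ \Big|\ \|\tilde y_{m,a}\|^2_{\ell_2,[1,L]}\le\epsilon\Big\}\in[0,\infty].$$ Theorem. The metric equals the optimal value (infimum, $+\infty$ if infeasible) of the semidefinite program $$\tilde\gamma(v_m,v_a,K)=\inf_{\gamma,P}\ \epsilon\gamma\quad\text{s.t.}\quad\begin{bmatrix}R&\tilde A^\top P\tilde B\\\tilde B^\top P\tilde A&\tilde B^\top P\tilde B\end{bmatrix}\preceq0,\quad\gamma\ge0,\quad P=P^\top\succeq0,$$ where $R=\tilde A^\top P\tilde A-P+\tilde C_p^\top\tilde C_p-\gamma\,\tilde C_m^\top\tilde C_m$. -/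

import Mathlib

open Filter Topology Matrix

noncomputable section

namespace WangElia

/-- Index set of the stacked network state `(x, z)`: `N` agents, each with `x_i, z_i ∈ ℝⁿ`. -/
abbrev State (N n : ℕ) : Type := (Fin N × Fin n) ⊕ (Fin N × Fin n)

/-- `K` is the symmetric weight matrix of the graph `G` as it enters the algorithm: for `i ≠ j`,
`K i j = -k_ij` with `k_ij > 0` on the edges of `G` and `k_ij = 0` off them, rows and columns sum
to zero (so `(K x)_i = ∑_j k_ij (x_i - x_j)`), and the spectral radius is less than one. -/
structure IsWeightMatrix {N : ℕ} (G : SimpleGraph (Fin N)) (K : Matrix (Fin N) (Fin N) ℝ) :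
    Prop where
  symm : K.IsSymm
  col_sum : ∀ j, ∑ i, K i j = 0
  adj : ∀ i j, G.Adj i j → K i j < 0
  not_adj : ∀ i j, i ≠ j → ¬ G.Adj i j → K i j = 0
  spectral : spectralRadius ℝ K < 1

/-- The global cost `F(x) = ∑_i (½ xᵀ Q_i x + c_iᵀ x)`. -/
def cost {N n : ℕ} (Q : Fin N → Matrix (Fin n) (Fin n) ℝ) (c : Fin N → Fin n → ℝ)
    (x : Fin n → ℝ) : ℝ :=
  ∑ i, ((1 / 2) * (x ⬝ᵥ (Q i *ᵥ x)) + c i ⬝ᵥ x)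

/-- `K` acting agent-wise on stacked vectors in `ℝ^{nN}`, i.e. `K ⊗ I_n`. -/
def stackK {N : ℕ} (n : ℕ) (K : Matrix (Fin N) (Fin N) ℝ) :
    Matrix (Fin N × Fin n) (Fin N × Fin n) ℝ :=
  Matrix.of fun p q => if p.2 = q.2 then K p.1 q.1 else 0

/-- `Q = diag[Q_1 … Q_N]`. -/
def stackQ {N n : ℕ} (Q : Fin N → Matrix (Fin n) (Fin n) ℝ) :
    Matrix (Fin N × Fin n) (Fin N × Fin n) ℝ :=
  Matrix.of fun p q => if p.1 = q.1 then Q p.1 p.2 q.2 else 0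

/-- `Ā = [[I - K - αQ, -K], [K, I]]`. -/
def Abar {N n : ℕ} (K : Matrix (Fin N) (Fin N) ℝ) (Q : Fin N → Matrix (Fin n) (Fin n) ℝ)
    (α : ℝ) : Matrix (State N n) (State N n) ℝ :=
  Matrix.fromBlocks (1 - stackK n K - α • stackQ Q) (-stackK n K) (stackK n K) 1

/-- The constant input `c̄` of the aggregated dynamics: the gradient step `-α ∇f_i` of agent `i`
contributes `-α c_i` to `x_i`, nothing enters `z`. -/
def cbar {N n : ℕ} (c : Fin N → Fin n → ℝ) (α : ℝ) : State N n → ℝ :=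
  Sum.elim (fun p => -(α * c p.1 p.2)) (fun _ => 0)

/-- `B̄ = [B; B]`: the attack of agent `va` enters both `x_va` and `z_va`. -/
def Bbar {N : ℕ} (n : ℕ) (va : Fin N) : Matrix (State N n) (Fin n) ℝ :=
  Matrix.of fun p s =>
    Sum.elim (fun r : Fin N × Fin n => if r = (va, s) then (1 : ℝ) else 0)
      (fun r : Fin N × Fin n => if r = (va, s) then (1 : ℝ) else 0) p

/-- `C̄_p`: the stacked consensus errors `x_i - x_{i+1}`, over consecutive agents. -/
def Cpbar (N n : ℕ) : Matrix (Fin (N - 1) × Fin n) (State N n) ℝ :=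
  Matrix.of fun r p =>
    Sum.elim
      (fun q : Fin N × Fin n =>
        if q.2 = r.2 then
          (if q.1.val = r.1.val then (1 : ℝ) else if q.1.val = r.1.val + 1 then -1 else 0)
        else 0)
      (fun _ => 0) p

/-- The matrix that extracts `x_m` and `z_m`. -/
def extract {N : ℕ} (n : ℕ) (vm : Fin N) : Matrix (Fin n ⊕ Fin n) (State N n) ℝ :=
  Matrix.fromBlocks
    (Matrix.of fun s p => if p = (vm, s) then (1 : ℝ) else 0) 0
    0 (Matrix.of fun s p => if p = (vm, s) then (1 : ℝ) else 0)

/-- `C̄_m = W Č_m`, where `W = diag(1 - w, w)` weighs the coordinates of `x_m` and `z_m`. -/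
def Cmbar {N n : ℕ} (vm : Fin N) (w : Fin n → ℝ) : Matrix (Fin n ⊕ Fin n) (State N n) ℝ :=
  Matrix.fromBlocks (Matrix.diagonal fun s => 1 - w s) 0 0 (Matrix.diagonal w) * extract n vm

/-- The attack-free iteration `x̄[k+1] = Ā x̄[k] + c̄`. -/
def nominal {N n : ℕ} (K : Matrix (Fin N) (Fin N) ℝ) (Q : Fin N → Matrix (Fin n) (Fin n) ℝ)
    (c : Fin N → Fin n → ℝ) (α : ℝ) (x0 : State N n → ℝ) : ℕ → State N n → ℝ
  | 0 => x0
  | k + 1 => Abar K Q α *ᵥ nominal K Q c α x0 k + cbar c α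

/-- The step size `α` is admissible: without an attack, the algorithm solves the optimization
problem, i.e. from every initial state every estimate `x_i[k]` converges to one and the same
minimizer of the global cost. -/
def IsAdmissibleStep {N n : ℕ} (K : Matrix (Fin N) (Fin N) ℝ)
    (Q : Fin N → Matrix (Fin n) (Fin n) ℝ) (c : Fin N → Fin n → ℝ) (α : ℝ) : Prop :=
  0 < α ∧ ∃ xstar : Fin n → ℝ, (∀ x, cost Q c xstar ≤ cost Q c x) ∧
    ∀ (x0 : State N n → ℝ) (i : Fin N),
      Tendsto (fun k => fun s => nominal K Q c α x0 k (Sum.inl (i, s))) atTop (𝓝 xstar)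

/-- Relative degree `1 + min {j ≥ 0 | C Aʲ B ≠ 0}` of the strictly proper system `(A, B, C, 0)`. -/
def relDegree {σ ι o : Type*} [Fintype σ] [DecidableEq σ] (A : Matrix σ σ ℝ) (B : Matrix σ ι ℝ)
    (C : Matrix o σ ℝ) : ℕ :=
  1 + sInf {j : ℕ | C * A ^ j * B ≠ 0}

/-- The delay `δ_m - δ_p` put on the performance output. The subtraction does not truncate:
a nontrivial network has `C̄_p B̄ ≠ 0`, hence `δ_p = 1`, and `δ_m ≥ 1`. -/
def delay {N n : ℕ} (K : Matrix (Fin N) (Fin N) ℝ) (Q : Fin N → Matrix (Fin n) (Fin n) ℝ)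
    (α : ℝ) (w : Fin n → ℝ) (va vm : Fin N) : ℕ :=
  relDegree (Abar K Q α) (Bbar n va) (Cmbar vm w) -
    relDegree (Abar K Q α) (Bbar n va) (Cpbar N n)

section Delayed

variable {σ ι o : Type*} [DecidableEq σ]

/-- State matrix of the system extended by `d` time-shifted copies of the state,
`x̃[k] = (x̄[k], x̄[k-1], …, x̄[k-d])`. -/
def Atilde (d : ℕ) (A : Matrix σ σ ℝ) : Matrix (Fin (d + 1) × σ) (Fin (d + 1) × σ) ℝ :=
  Matrix.of fun p q =>
    if p.1.val = 0 then (if q.1.val = 0 then A p.2 q.2 else 0)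
    else if p.1.val = q.1.val + 1 ∧ p.2 = q.2 then 1 else 0

/-- Input matrix of the extended system. -/
def Btilde (d : ℕ) (B : Matrix σ ι ℝ) : Matrix (Fin (d + 1) × σ) ι ℝ :=
  Matrix.of fun p j => if p.1.val = 0 then B p.2 j else 0

/-- Output matrix reading `C x̄[k-d]` from the extended state (the delayed output). -/
def Cdelayed (d : ℕ) (C : Matrix o σ ℝ) : Matrix o (Fin (d + 1) × σ) ℝ :=
  Matrix.of fun r q => if q.1.val = d then C r q.2 else 0

/-- Output matrix reading `C x̄[k]` from the extended state (no delay). -/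
def Ccurrent (d : ℕ) (C : Matrix o σ ℝ) : Matrix o (Fin (d + 1) × σ) ℝ :=
  Matrix.of fun r q => if q.1.val = 0 then C r q.2 else 0

end Delayed

section Generic

variable {σ ι o₁ o₂ : Type*} [Fintype σ] [Fintype ι] [Fintype o₁] [Fintype o₂]

/-- Attack-induced state: `x[0] = 0`, `x[k+1] = A x[k] + B a[k]`. -/
def response (A : Matrix σ σ ℝ) (B : Matrix σ ι ℝ) (a : ℕ → ι → ℝ) : ℕ → σ → ℝ
  | 0 => 0
  | k + 1 => A *ᵥ response A B a k + B *ᵥ a k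

/-- Energy `‖y‖²_{ℓ₂,[1,L]}` of the output `y = C x` caused by the attack `a`. -/
def outputEnergy (A : Matrix σ σ ℝ) (B : Matrix σ ι ℝ) (C : Matrix o₁ σ ℝ) (L : ℕ)
    (a : ℕ → ι → ℝ) : ℝ :=
  ∑ k ∈ Finset.Icc 1 L, ∑ r, ((C *ᵥ response A B a k) r) ^ 2

/-- The metric with horizon `L`: the supremum of the performance energy on `[1,L]` over all attacks
whose detection energy on `[1,L]` is at most `ε`. The attacks range over `ℓ_{2e}`, which consists of
all sequences, because every truncation of a sequence has finite energy. -/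
def horizonMetric (A : Matrix σ σ ℝ) (B : Matrix σ ι ℝ) (Cp : Matrix o₁ σ ℝ) (Cm : Matrix o₂ σ ℝ)
    (ε : ℝ) (L : ℕ) : EReal :=
  sSup {v : EReal | ∃ a : ℕ → ι → ℝ, outputEnergy A B Cm L a ≤ ε ∧
    v = ((outputEnergy A B Cp L a : ℝ) : EReal)}

/-- The metric: supremum over all attacks and all horizons `L ≥ 1`, as an extended real. -/
def metric (A : Matrix σ σ ℝ) (B : Matrix σ ι ℝ) (Cp : Matrix o₁ σ ℝ) (Cm : Matrix o₂ σ ℝ)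
    (ε : ℝ) : EReal :=
  ⨆ (L : ℕ) (_ : 1 ≤ L), horizonMetric A B Cp Cm ε L

/-- The block matrix of the linear matrix inequality, with
`R = AᵀPA - P + C_pᵀC_p - γ C_mᵀC_m`. -/
def lmiMatrix (A : Matrix σ σ ℝ) (B : Matrix σ ι ℝ) (Cp : Matrix o₁ σ ℝ) (Cm : Matrix o₂ σ ℝ)
    (γ : ℝ) (P : Matrix σ σ ℝ) : Matrix (σ ⊕ ι) (σ ⊕ ι) ℝ :=
  Matrix.fromBlocks (Aᵀ * P * A - P + Cpᵀ * Cp - γ • (Cmᵀ * Cm)) (Aᵀ * P * B)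
    (Bᵀ * P * A) (Bᵀ * P * B)

/-- Optimal value of the semidefinite program: the infimum of `ε γ` over `γ ≥ 0` and
`P = Pᵀ ⪰ 0` with `lmiMatrix ⪯ 0`; it is `⊤` if no pair `(γ, P)` is feasible. -/
def sdpValue (A : Matrix σ σ ℝ) (B : Matrix σ ι ℝ) (Cp : Matrix o₁ σ ℝ) (Cm : Matrix o₂ σ ℝ)
    (ε : ℝ) : EReal :=
  sInf {v : EReal | ∃ (γ : ℝ) (P : Matrix σ σ ℝ), 0 ≤ γ ∧ P.PosSemidef ∧
    (-(lmiMatrix A B Cp Cm γ P)).PosSemidef ∧ v = ((ε * γ : ℝ) : EReal)}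

end Generic

end WangElia

end

noncomputable section

namespace WangElia

/-! One inequality is weak duality: the linear matrix inequality says that `x ⬝ᵥ P *ᵥ x` is a
storage function for the supply `γ‖C_m x‖² - ‖C_p x‖²`, and summing it along a trajectory from rest
bounds the performance energy by `γ` times the detection energy.

For the converse, let the metric be finite, equal to `εγ`. Scaling attacks turns this into the gain
bound `‖y_p‖² ≤ γ‖y_m‖²` on every horizon. The natural storage function is the required supply: the
least supply with which a state is reached from rest. Attacks alone need not reach every state, so a
disturbance input `E = 1 - B̃ S̃` is added, where `S̃` reads the sum of the dual variables `z_i` off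
the current state. Attack and disturbance together reach every state in one step. The disturbance is
`ℓ₂`-stable: the dual sum is conserved by `Ā`, `E` leaves it untouched, and on zero dual sum `Ā ^ k`
tends to `0` because the nominal algorithm converges (`tendsto_Abar_pow_mulVec`). Hence for every `θ
> 0` the gain bound survives with `(1 + θ)² γ` at the price of a term `M‖e‖²`
(`exists_disturbance_gain`).

For this supply the required supply is finite and nonnegative. It is a quadratic form because it
inherits, as an inequality, a parallelogram law that forces equality (`RotationIdentity.of_le`). Its
matrix `P` is feasible for `(1 + θ)² γ` once the disturbance is set to zero
(`exists_storage_matrix`), and `θ → 0` gives the infimum, attained or not. -/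

/-- The parallelogram identity for arbitrary scaled rotations of the pair `(x, y)`. -/
def RotationIdentity {E : Type*} [AddCommGroup E] [Module ℝ E] (V : E → ℝ) : Prop :=
  ∀ (p r : ℝ) (x y : E),
    V (p • x + r • y) + V (r • x - p • y) = (p ^ 2 + r ^ 2) * (V x + V y)

/-! ### Quadratic forms characterized by a parallelogram law -/

namespace RotationIdentity

variable {E : Type*} [AddCommGroup E] [Module ℝ E] {V : E → ℝ}

theorem map_zero (h : RotationIdentity V) : V 0 = 0 := by
  have := h 0 0 0 0
  simp at this
  exact this

theorem map_smul (h : RotationIdentity V) (p : ℝ) (x : E) : V (p • x) = p ^ 2 * V x := by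
  have := h p 0 x 0
  simpa [h.map_zero] using this

theorem map_neg (h : RotationIdentity V) (x : E) : V (-x) = V x := by
  simpa using h.map_smul (-1) x

theorem parallelogram (h : RotationIdentity V) (x y : E) :
    V (x + y) + V (x - y) = 2 * (V x + V y) := by
  have := h 1 1 x y
  norm_num at this
  exact this

/-- The polar form of a function satisfying the rotation identity. -/
def polar (V : E → ℝ) (x y : E) : ℝ := (V (x + y) - V (x - y)) / 4

theorem polar_self (h : RotationIdentity V) (x : E) : polar V x x = V x := by
  have := h.map_smul 2 x
  rw [two_smul] at this
  simp only [polar, sub_self, h.map_zero, this]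
  ring

theorem polar_comm (h : RotationIdentity V) (x y : E) : polar V x y = polar V y x := by
  have := h.map_neg (x - y)
  rw [neg_sub] at this
  rw [polar, polar, add_comm y x, this]

/-- Three parallelogram laws determine `V (x + x' + z)`; at `z = y` and `z = -y` all terms even in
`z` cancel in the difference. -/
theorem polar_add_left (h : RotationIdentity V) (x x' y : E) :
    polar V (x + x') y = polar V x y + polar V x' y := by
  have key : ∀ z : E, V (x + x' + z) =
      V (x + z) + V (x' + z) + V x + V x' - V z - V (x - x') := by
    intro z
    have h1 := h.parallelogram (x + z) x'
    have h2 := h.parallelogram (x' + z) x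
    have h3 := h.parallelogram z (x - x')
    rw [show x + z + x' = x + x' + z by abel, show x + z - x' = z + (x - x') by abel] at h1
    rw [show x' + z + x = x + x' + z by abel, show x' + z - x = z - (x - x') by abel] at h2
    linarith
  have h1 := key y
  have h2 := key (-y)
  rw [h.map_neg] at h2
  simp only [← sub_eq_add_neg] at h2
  simp only [polar, h1, h2]
  ring

theorem polar_neg_left (h : RotationIdentity V) (x y : E) : polar V (-x) y = -polar V x y := by
  have h1 := h.map_neg (x - y)
  have h2 := h.map_neg (x + y)
  rw [neg_sub] at h1
  rw [neg_add] at h2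
  rw [polar, polar, show -x + y = y - x by abel, show -x - y = -x + -y by abel, h1, h2]
  ring

/-- The rotations `(t, 1)` and `(t, -1)` give the same right-hand side; comparing the left-hand
sides moves the scalar across. -/
theorem polar_smul_comm (h : RotationIdentity V) (t : ℝ) (x y : E) :
    polar V (t • x) y = polar V x (t • y) := by
  have h1 := h t 1 x y
  have h2 := h t (-1) x y
  have h3 := h.map_neg (x + t • y)
  rw [show -(x + t • y) = (-1 : ℝ) • x - t • y by module] at h3
  rw [show t • x + (-1 : ℝ) • y = t • x - y by module, h3] at h2
  rw [one_smul, one_smul] at h1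
  rw [polar, polar]
  linarith

/-- Homogeneity needs no continuity: every nonnegative real is a square `s²`, and one factor `s` can
be moved to the other argument. -/
theorem polar_smul_left (h : RotationIdentity V) (t : ℝ) (x y : E) :
    polar V (t • x) y = t * polar V x y := by
  have hsq : ∀ s : ℝ, polar V ((s ^ 2) • x) y = s ^ 2 * polar V x y := by
    intro s
    rw [pow_two, mul_smul, h.polar_smul_comm, polar, ← smul_add, ← smul_sub, h.map_smul,
      h.map_smul, polar]
    ring
  rcases le_total 0 t with ht | ht
  · simpa [Real.sq_sqrt ht] using hsq (√t)
  · have := hsq (√(-t))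
    rw [Real.sq_sqrt (by linarith), neg_smul, h.polar_neg_left] at this
    linarith

/-- The polar form as a bilinear map. -/
def bilin (h : RotationIdentity V) : E →ₗ[ℝ] E →ₗ[ℝ] ℝ :=
  LinearMap.mk₂ ℝ (polar V) h.polar_add_left h.polar_smul_left
    (fun x y y' => by
      rw [h.polar_comm, h.polar_add_left, h.polar_comm y, h.polar_comm y'])
    (fun t x y => by rw [h.polar_comm, h.polar_smul_left, h.polar_comm y, smul_eq_mul])

theorem exists_matrix {σ : Type*} [Fintype σ] {V : (σ → ℝ) → ℝ} (h : RotationIdentity V)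
    (h0 : ∀ x, 0 ≤ V x) :
    ∃ P : Matrix σ σ ℝ, P.PosSemidef ∧ ∀ x, x ⬝ᵥ P *ᵥ x = V x := by
  classical
  have hP : ∀ x, x ⬝ᵥ LinearMap.toMatrix₂' ℝ h.bilin *ᵥ x = V x := fun x => by
    rw [← Matrix.toLinearMap₂'_apply', Matrix.toLinearMap₂'_toMatrix']
    exact h.polar_self x
  refine ⟨LinearMap.toMatrix₂' ℝ h.bilin, .of_dotProduct_mulVec_nonneg ?_ ?_, hP⟩
  · ext i j
    simp only [conjTranspose_apply, LinearMap.toMatrix₂'_apply, star_trivial]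
    exact h.polar_comm _ _
  · intro x
    rw [star_trivial, hP]
    exact h0 x

/-- The map `(x, y) ↦ (p x + r y, r x - p y)` squares to multiplication by `p² + r²`, so the
inequality at the rotated pair is the reverse inequality at `(x, y)`. This suits infima, which yield
one direction only. -/
theorem of_le (hs : ∀ (p : ℝ) (x : E), V (p • x) ≤ p ^ 2 * V x)
    (h : ∀ (p r : ℝ) (x y : E),
      V (p • x + r • y) + V (r • x - p • y) ≤ (p ^ 2 + r ^ 2) * (V x + V y))
    (h0 : ∀ x, 0 ≤ V x) : RotationIdentity V := by
  have hz : V 0 = 0 := le_antisymm (by simpa using hs 0 0) (h0 0)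
  have hs' : ∀ (p : ℝ) (x : E), V (p • x) = p ^ 2 * V x := by
    intro p x
    refine le_antisymm (hs p x) ?_
    rcases eq_or_ne p 0 with rfl | hp
    · simpa using h0 _
    · have := hs p⁻¹ (p • x)
      rw [smul_smul, inv_mul_cancel₀ hp, one_smul] at this
      calc p ^ 2 * V x ≤ p ^ 2 * (p⁻¹ ^ 2 * V (p • x)) := by gcongr
        _ = V (p • x) := by field_simp
  intro p r x y
  refine le_antisymm (h p r x y) ?_
  have h1 := h p r (p • x + r • y) (r • x - p • y)
  rw [show p • (p • x + r • y) + r • (r • x - p • y) = (p ^ 2 + r ^ 2) • x by module,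
    show r • (p • x + r • y) - p • (r • x - p • y) = (p ^ 2 + r ^ 2) • y by module,
    hs', hs', ← mul_add, pow_two (p ^ 2 + r ^ 2), mul_assoc] at h1
  rcases (add_nonneg (sq_nonneg p) (sq_nonneg r)).eq_or_lt with h2 | h2
  · rw [← h2]
    simpa using add_nonneg (h0 _) (h0 _)
  · exact le_of_mul_le_mul_left h1 h2

end RotationIdentity

/-! ### Trajectories from rest and the required supply -/

section Response

variable {σ ι κ : Type*} [Fintype σ] [Fintype ι] [Fintype κ]

theorem response_combination (A : Matrix σ σ ℝ) (B : Matrix σ ι ℝ) (p r : ℝ)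
    (a b : ℕ → ι → ℝ) (k : ℕ) :
    response A B (fun j => p • a j + r • b j) k =
      p • response A B a k + r • response A B b k := by
  induction k with
  | zero => simp [response]
  | succ k ih =>
    simp only [response, ih, mulVec_add, mulVec_smul]
    module

theorem response_smul (A : Matrix σ σ ℝ) (B : Matrix σ ι ℝ) (p : ℝ)
    (a : ℕ → ι → ℝ) (k : ℕ) :
    response A B (fun j => p • a j) k = p • response A B a k := by
  simpa using response_combination A B p 0 a 0 k

theorem response_congr (A : Matrix σ σ ℝ) (B : Matrix σ ι ℝ) {a b : ℕ → ι → ℝ} {k : ℕ}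
    (h : ∀ j < k, a j = b j) : response A B a k = response A B b k := by
  induction k with
  | zero => rfl
  | succ k ih =>
    simp only [response]
    rw [ih fun j hj => h j (by omega), h k (by omega)]

/-- The input sequence delayed by one step. -/
def delayInput (a : ℕ → ι → ℝ) : ℕ → ι → ℝ
  | 0 => 0
  | k + 1 => a k

theorem response_delayInput (A : Matrix σ σ ℝ) (B : Matrix σ ι ℝ) (a : ℕ → ι → ℝ) (k : ℕ) :
    response A B (delayInput a) (k + 1) = response A B a k := by
  induction k with
  | zero => simp [response, delayInput]
  | succ k ih =>
    rw [response, ih]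
    rfl

/-- The total supply absorbed on the first `T` steps of the trajectory driven by `u` from rest. -/
def supplied (A : Matrix σ σ ℝ) (W : Matrix σ κ ℝ) (s : (σ → ℝ) × (κ → ℝ) → ℝ) (T : ℕ)
    (u : ℕ → κ → ℝ) : ℝ :=
  ∑ k ∈ Finset.range T, s (response A W u k, u k)

/-- The supplies with which the state `x` can be reached from rest. -/
def reachingSupplies (A : Matrix σ σ ℝ) (W : Matrix σ κ ℝ) (s : (σ → ℝ) × (κ → ℝ) → ℝ)
    (x : σ → ℝ) : Set ℝ :=
  {v | ∃ T u, response A W u T = x ∧ supplied A W s T u = v}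

variable {A : Matrix σ σ ℝ} {W : Matrix σ κ ℝ} {s : (σ → ℝ) × (κ → ℝ) → ℝ}

theorem supplied_combination (hs : RotationIdentity s) (p r : ℝ) (T : ℕ) (u v : ℕ → κ → ℝ) :
    supplied A W s T (fun k => p • u k + r • v k) +
        supplied A W s T (fun k => r • u k + (-p) • v k) =
      (p ^ 2 + r ^ 2) * (supplied A W s T u + supplied A W s T v) := by
  simp only [supplied, ← Finset.sum_add_distrib, Finset.mul_sum]
  refine Finset.sum_congr rfl fun k _ => ?_
  rw [← hs, response_combination, response_combination]
  congr 2
  ext <;> simp [sub_eq_add_neg]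

/-- Waiting at rest is free, since the supply vanishes at zero. Inputs with different horizons can
thus be aligned before they are combined. -/
theorem exists_longer_input (hs : RotationIdentity s) {T T' : ℕ} (hT : T ≤ T')
    (u : ℕ → κ → ℝ) : ∃ u', response A W u' T' = response A W u T ∧
      supplied A W s T' u' = supplied A W s T u := by
  induction T', hT using Nat.le_induction with
  | base => exact ⟨u, rfl, rfl⟩
  | succ m _ ih =>
    obtain ⟨u', h1, h2⟩ := ih
    refine ⟨delayInput u', by rw [response_delayInput, h1], ?_⟩
    rw [← h2, supplied, Finset.sum_range_succ', supplied]
    simp only [response_delayInput, show ∀ k, delayInput u' (k + 1) = u' k from fun _ => rfl,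
      show delayInput u' 0 = 0 from rfl, show response A W (delayInput u') 0 = 0 from rfl]
    have : s ((0 : σ → ℝ), (0 : κ → ℝ)) = 0 := hs.map_zero
    rw [this, add_zero]

/-- The storage function is the required supply `V`. Rotating a pair of nearly optimal inputs
rotates their endpoints, so `V` satisfies the hypotheses of `RotationIdentity.of_le`. -/
theorem exists_storage_matrix (hs : RotationIdentity s)
    (hreach : ∀ x, ∃ u, W *ᵥ u = x) (hnn : ∀ T u, 0 ≤ supplied A W s T u) :
    ∃ P : Matrix σ σ ℝ, P.PosSemidef ∧ ∀ x u,
      (A *ᵥ x + W *ᵥ u) ⬝ᵥ P *ᵥ (A *ᵥ x + W *ᵥ u) ≤ x ⬝ᵥ P *ᵥ x + s (x, u) := by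
  set V : (σ → ℝ) → ℝ := fun x => sInf (reachingSupplies A W s x) with hV
  have hbdd : ∀ x, BddBelow (reachingSupplies A W s x) := fun x =>
    ⟨0, by rintro v ⟨T, u, -, rfl⟩; exact hnn T u⟩
  have hne : ∀ x, (reachingSupplies A W s x).Nonempty := by
    intro x
    obtain ⟨u, hu⟩ := hreach x
    -- From rest the state after one step is `W *ᵥ u`, so a single step reaches `x`.
    exact ⟨_, 1, fun _ => u, by simp [response, hu], rfl⟩
  have hle : ∀ T u, V (response A W u T) ≤ supplied A W s T u := fun T u =>
    csInf_le (hbdd _) ⟨T, u, rfl, rfl⟩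
  have hlt : ∀ x, ∀ δ > 0, ∃ T u, response A W u T = x ∧ supplied A W s T u < V x + δ := by
    intro x δ hδ
    obtain ⟨_, ⟨T, u, h1, rfl⟩, h2⟩ := exists_lt_of_csInf_lt (hne x)
      (show sInf (reachingSupplies A W s x) < V x + δ by simp only [hV]; linarith)
    exact ⟨T, u, h1, h2⟩
  have h0 : ∀ x, 0 ≤ V x := fun x => le_csInf (hne x) (by
    rintro v ⟨T, u, -, rfl⟩; exact hnn T u)
  have hrot : ∀ (p r : ℝ) (x y : σ → ℝ),
      V (p • x + r • y) + V (r • x - p • y) ≤ (p ^ 2 + r ^ 2) * (V x + V y) := by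
    intro p r x y
    refine le_of_forall_pos_le_add fun δ hδ => ?_
    set δ' := δ / (2 * (p ^ 2 + r ^ 2 + 1)) with hδ'
    have hδ0 : 0 < δ' := by positivity
    obtain ⟨T, u, hu, hu'⟩ := hlt x δ' hδ0
    obtain ⟨S, v, hv, hv'⟩ := hlt y δ' hδ0
    obtain ⟨u₁, h1, h2⟩ := exists_longer_input (A := A) (W := W) hs (le_max_left T S) u
    obtain ⟨v₁, h3, h4⟩ := exists_longer_input (A := A) (W := W) hs (le_max_right T S) v
    have h5 := hle (max T S) (fun k => p • u₁ k + r • v₁ k)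
    have h6 := hle (max T S) (fun k => r • u₁ k + (-p) • v₁ k)
    rw [response_combination, h1, h3, hu, hv] at h5 h6
    have h7 := supplied_combination (A := A) (W := W) hs p r (max T S) u₁ v₁
    rw [h2, h4] at h7
    rw [neg_smul, ← sub_eq_add_neg] at h6
    have h8 : (p ^ 2 + r ^ 2) * (supplied A W s T u + supplied A W s S v) ≤
        (p ^ 2 + r ^ 2) * (V x + V y + 2 * δ') := by
      exact mul_le_mul_of_nonneg_left (by linarith) (by positivity)
    have h9 : (p ^ 2 + r ^ 2) * (2 * δ') ≤ δ := by
      calc (p ^ 2 + r ^ 2) * (2 * δ') ≤ (p ^ 2 + r ^ 2 + 1) * (2 * δ') :=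
            mul_le_mul_of_nonneg_right (by linarith) (by positivity)
        _ = δ := by rw [hδ']; field_simp
    linarith
  have hsm : ∀ (p : ℝ) (x : σ → ℝ), V (p • x) ≤ p ^ 2 * V x := by
    intro p x
    refine le_of_forall_pos_le_add fun δ hδ => ?_
    obtain ⟨T, u, hu, hu'⟩ := hlt x (δ / (p ^ 2 + 1)) (by positivity)
    have h5 := hle T (fun k => p • u k)
    have h6 : supplied A W s T (fun k => p • u k) = p ^ 2 * supplied A W s T u := by
      simp only [supplied, Finset.mul_sum, response_smul, ← hs.map_smul]
      rfl
    rw [response_smul, hu, h6] at h5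
    have h9 : p ^ 2 * (δ / (p ^ 2 + 1)) ≤ δ := by
      calc p ^ 2 * (δ / (p ^ 2 + 1)) ≤ (p ^ 2 + 1) * (δ / (p ^ 2 + 1)) :=
            mul_le_mul_of_nonneg_right (by linarith) (by positivity)
        _ = δ := by field_simp
    have h8 : p ^ 2 * supplied A W s T u ≤ p ^ 2 * (V x + δ / (p ^ 2 + 1)) := by gcongr
    linarith
  obtain ⟨P, hP, hPV⟩ := (RotationIdentity.of_le hsm hrot h0).exists_matrix h0
  refine ⟨P, hP, fun x u => ?_⟩
  rw [hPV, hPV]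
  refine le_of_forall_pos_le_add fun δ hδ => ?_
  obtain ⟨T, v, hv, hv'⟩ := hlt x δ hδ
  -- Dynamic programming: reach `x` almost optimally, then apply `u` for one more step.
  set v' : ℕ → κ → ℝ := fun k => if k < T then v k else u with hv'_def
  have hresp : ∀ k ≤ T, response A W v' k = response A W v k := fun k hk =>
    response_congr A W fun j hj => by simp [hv'_def, show j < T by omega]
  have hsup : supplied A W s (T + 1) v' = supplied A W s T v + s (x, u) := by
    rw [supplied, Finset.sum_range_succ, supplied, hresp T le_rfl, hv]
    congr 1
    · refine Finset.sum_congr rfl fun k hk => ?_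
      have hk := Finset.mem_range.1 hk
      rw [hresp k hk.le]
      simp [hv'_def, hk]
    · simp [hv'_def]
  have h1 := hle (T + 1) v'
  rw [hsup, response, hresp T le_rfl, hv] at h1
  simp only [hv'_def, lt_irrefl, if_false] at h1
  linarith

end Response

/-! ### Squared norms -/

section NormSq

variable {o σ : Type*} [Fintype o] [Fintype σ]

/-- The squared Euclidean norm. -/
def normSq (v : o → ℝ) : ℝ := ∑ r, v r ^ 2

theorem normSq_nonneg (v : o → ℝ) : 0 ≤ normSq v := Finset.sum_nonneg fun _ _ => sq_nonneg _

theorem rotationIdentity_normSq : RotationIdentity (normSq : (o → ℝ) → ℝ) := fun p r x y => by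
  simp only [normSq, mul_add, Finset.mul_sum, ← Finset.sum_add_distrib]
  refine Finset.sum_congr rfl fun i _ => ?_
  simp only [Pi.add_apply, Pi.sub_apply, Pi.smul_apply, smul_eq_mul]
  ring

theorem normSq_zero : normSq (0 : o → ℝ) = 0 := rotationIdentity_normSq.map_zero

/-- Young's inequality; the factor `1 + θ` must be close to one because it multiplies the gain. -/
theorem normSq_add_le (u v : o → ℝ) {θ : ℝ} (hθ : 0 < θ) :
    normSq (u + v) ≤ (1 + θ) * normSq u + (1 + θ⁻¹) * normSq v := by
  simp only [normSq, Finset.mul_sum, ← Finset.sum_add_distrib]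
  refine Finset.sum_le_sum fun i _ => ?_
  have h : 0 ≤ θ⁻¹ * (θ * u i - v i) ^ 2 := by positivity
  have h' : θ⁻¹ * (θ * u i - v i) ^ 2 = θ * u i ^ 2 - 2 * u i * v i + θ⁻¹ * v i ^ 2 := by
    field_simp
    ring
  rw [Pi.add_apply]
  nlinarith

theorem normSq_mulVec_le (C : Matrix o σ ℝ) (x : σ → ℝ) :
    normSq (C *ᵥ x) ≤ (∑ i, ∑ j, C i j ^ 2) * normSq x := by
  rw [normSq, Finset.sum_mul]
  exact Finset.sum_le_sum fun i _ => Finset.sum_mul_sq_le_sq_mul_sq _ _ _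

theorem dotProduct_transpose_mul_mulVec (C : Matrix o σ ℝ) (x : σ → ℝ) :
    x ⬝ᵥ (Cᵀ * C) *ᵥ x = normSq (C *ᵥ x) := by
  rw [← mulVec_mulVec, dotProduct_mulVec, vecMul_transpose, normSq, dotProduct]
  simp [pow_two]

end NormSq

/-! ### Weak and strong duality -/

section Duality

variable {σ ι o₁ o₂ : Type*} [Fintype σ] [Fintype ι] [Fintype o₁] [Fintype o₂]
  {A : Matrix σ σ ℝ} {B : Matrix σ ι ℝ} {Cp : Matrix o₁ σ ℝ} {Cm : Matrix o₂ σ ℝ}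

theorem dotProduct_transpose_mul_mul_mulVec {l m : Type*} [Fintype l] [Fintype m]
    (X : Matrix σ l ℝ) (P : Matrix σ σ ℝ) (Y : Matrix σ m ℝ) (u : l → ℝ) (v : m → ℝ) :
    u ⬝ᵥ (Xᵀ * P * Y) *ᵥ v = (X *ᵥ u) ⬝ᵥ P *ᵥ (Y *ᵥ v) := by
  rw [← mulVec_mulVec, ← mulVec_mulVec, dotProduct_mulVec u, vecMul_transpose]

theorem dotProduct_lmiMatrix_mulVec (γ : ℝ) (P : Matrix σ σ ℝ) (x : σ → ℝ) (a : ι → ℝ) :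
    Sum.elim x a ⬝ᵥ lmiMatrix A B Cp Cm γ P *ᵥ Sum.elim x a =
      (A *ᵥ x + B *ᵥ a) ⬝ᵥ P *ᵥ (A *ᵥ x + B *ᵥ a) - x ⬝ᵥ P *ᵥ x + normSq (Cp *ᵥ x)
        - γ * normSq (Cm *ᵥ x) := by
  rw [lmiMatrix, fromBlocks_mulVec, sumElim_dotProduct_sumElim]
  simp only [Sum.elim_comp_inl, Sum.elim_comp_inr, add_mulVec, sub_mulVec, smul_mulVec,
    dotProduct_add, dotProduct_sub, dotProduct_smul, dotProduct_transpose_mul_mul_mulVec, dotProduct_transpose_mul_mulVec,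
    mulVec_add, add_dotProduct, smul_eq_mul]
  ring

/-- The quadratic form of the block matrix at `(x, a)` is the storage increase minus the supply. -/
theorem neg_lmiMatrix_posSemidef_iff {γ : ℝ} {P : Matrix σ σ ℝ} (hP : P.PosSemidef) :
    (-(lmiMatrix A B Cp Cm γ P)).PosSemidef ↔ ∀ x a,
      (A *ᵥ x + B *ᵥ a) ⬝ᵥ P *ᵥ (A *ᵥ x + B *ᵥ a) ≤
        x ⬝ᵥ P *ᵥ x + (γ * normSq (Cm *ᵥ x) - normSq (Cp *ᵥ x)) := by
  have hsymm : Pᵀ = P := by simpa using hP.isHermitian.eq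
  constructor
  · intro h x a
    have := h.dotProduct_mulVec_nonneg (Sum.elim x a)
    rw [star_trivial, neg_mulVec, dotProduct_neg, dotProduct_lmiMatrix_mulVec] at this
    linarith
  · intro h
    refine .of_dotProduct_mulVec_nonneg ?_ fun v => ?_
    · refine IsHermitian.neg ?_
      rw [IsHermitian, conjTranspose_eq_transpose_of_trivial, lmiMatrix, fromBlocks_transpose]
      simp only [transpose_add, transpose_sub, transpose_smul, transpose_mul,
        transpose_transpose, hsymm, Matrix.mul_assoc]
    · have := h (v ∘ Sum.inl) (v ∘ Sum.inr)
      rw [star_trivial, neg_mulVec, dotProduct_neg, ← Sum.elim_comp_inl_inr v,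
        dotProduct_lmiMatrix_mulVec]
      linarith

theorem outputEnergy_eq_sum_range (A : Matrix σ σ ℝ) (B : Matrix σ ι ℝ) (C : Matrix o₁ σ ℝ)
    (L : ℕ) (a : ℕ → ι → ℝ) :
    outputEnergy A B C L a =
      ∑ k ∈ Finset.range (L + 1), normSq (C *ᵥ response A B a k) := by
  rw [Finset.range_eq_Ico, Finset.sum_eq_sum_Ico_succ_bot (Nat.succ_pos L)]
  simp only [response, mulVec_zero, normSq_zero, zero_add]
  rfl

theorem outputEnergy_nonneg (A : Matrix σ σ ℝ) (B : Matrix σ ι ℝ) (C : Matrix o₁ σ ℝ)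
    (L : ℕ) (a : ℕ → ι → ℝ) : 0 ≤ outputEnergy A B C L a := by
  rw [outputEnergy_eq_sum_range]
  exact Finset.sum_nonneg fun _ _ => normSq_nonneg _

theorem outputEnergy_smul (A : Matrix σ σ ℝ) (B : Matrix σ ι ℝ) (C : Matrix o₁ σ ℝ)
    (L : ℕ) (t : ℝ) (a : ℕ → ι → ℝ) :
    outputEnergy A B C L (fun k => t • a k) = t ^ 2 * outputEnergy A B C L a := by
  simp only [outputEnergy_eq_sum_range, response_smul, mulVec_smul, Finset.mul_sum,
    rotationIdentity_normSq.map_smul]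

theorem outputEnergy_zero (A : Matrix σ σ ℝ) (B : Matrix σ ι ℝ) (C : Matrix o₁ σ ℝ) (L : ℕ) :
    outputEnergy A B C L 0 = 0 := by
  have h : (fun k : ℕ => (0 : ℝ) • (0 : ℕ → ι → ℝ) k) = 0 := by ext; simp
  rw [← h, outputEnergy_smul]
  simp

/-- The dissipation inequality telescopes from zero initial storage, and the final storage is
nonnegative. -/
theorem outputEnergy_le_of_lmi {γ : ℝ} {P : Matrix σ σ ℝ} (hP : P.PosSemidef)
    (h : (-(lmiMatrix A B Cp Cm γ P)).PosSemidef) (L : ℕ) (a : ℕ → ι → ℝ) :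
    outputEnergy A B Cp L a ≤ γ * outputEnergy A B Cm L a := by
  rw [neg_lmiMatrix_posSemidef_iff hP] at h
  have key : ∀ T, response A B a T ⬝ᵥ P *ᵥ response A B a T ≤
      γ * ∑ k ∈ Finset.range T, normSq (Cm *ᵥ response A B a k) -
        ∑ k ∈ Finset.range T, normSq (Cp *ᵥ response A B a k) := by
    intro T
    induction T with
    | zero => simp [response]
    | succ T ih =>
      rw [Finset.sum_range_succ, Finset.sum_range_succ]
      have := h (response A B a T) (a T)
      rw [response]
      linarith
  have h1 := hP.dotProduct_mulVec_nonneg (response A B a (L + 1))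
  rw [star_trivial] at h1
  rw [outputEnergy_eq_sum_range, outputEnergy_eq_sum_range]
  linarith [key (L + 1)]

theorem metric_le_sdpValue {ε : ℝ} : metric A B Cp Cm ε ≤ sdpValue A B Cp Cm ε := by
  refine le_sInf ?_
  rintro _ ⟨γ, P, hγ, hP, hlmi, rfl⟩
  refine iSup₂_le fun L _ => sSup_le ?_
  rintro _ ⟨a, ha, rfl⟩
  rw [EReal.coe_le_coe_iff]
  calc _ ≤ γ * outputEnergy A B Cm L a := outputEnergy_le_of_lmi hP hlmi L a
    _ ≤ γ * ε := by gcongr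
    _ = ε * γ := mul_comm _ _

theorem le_metric {ε : ℝ} {L : ℕ} (hL : 1 ≤ L) {a : ℕ → ι → ℝ}
    (ha : outputEnergy A B Cm L a ≤ ε) :
    ((outputEnergy A B Cp L a : ℝ) : EReal) ≤ metric A B Cp Cm ε :=
  le_iSup₂_of_le L hL (le_sSup ⟨a, ha, rfl⟩)

theorem metric_nonneg {ε : ℝ} (hε : 0 < ε) : 0 ≤ metric A B Cp Cm ε := by
  have := le_metric (Cp := Cp) le_rfl ((outputEnergy_zero A B Cm 1).trans_le hε.le)
  rwa [outputEnergy_zero] at this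

/-- Both energies are quadratic in the attack, so an attack can be rescaled to use exactly the
detection budget `ε`. -/
theorem outputEnergy_le_of_metric_le {ε γ : ℝ} (hε : 0 < ε)
    (h : metric A B Cp Cm ε ≤ ((ε * γ : ℝ) : EReal)) (L : ℕ) (a : ℕ → ι → ℝ) :
    outputEnergy A B Cp L a ≤ γ * outputEnergy A B Cm L a := by
  rcases L.eq_zero_or_pos with rfl | hL
  · simp [outputEnergy]
  have key : ∀ t : ℝ, t ^ 2 * outputEnergy A B Cm L a ≤ ε →
      t ^ 2 * outputEnergy A B Cp L a ≤ ε * γ := by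
    intro t ht
    rw [← outputEnergy_smul] at ht ⊢
    exact EReal.coe_le_coe_iff.1 ((le_metric hL ht).trans h)
  rcases (outputEnergy_nonneg A B Cm L a).eq_or_lt with h0 | h0
  · rw [← h0, mul_zero]
    by_contra! hp
    -- An undetected attack may be scaled at will; this factor would produce performance energy `ε *
    -- γ + 1`.
    have h1 := key √((ε * γ + 1) / outputEnergy A B Cp L a) (by rw [← h0, mul_zero]; exact hε.le)
    have h2 : 0 ≤ ε * γ := by simpa using key 0 (by simpa using hε.le)
    rw [Real.sq_sqrt (by positivity), div_mul_cancel₀ _ hp.ne'] at h1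
    linarith
  · have h1 := key √(ε / outputEnergy A B Cm L a) (by
      rw [Real.sq_sqrt (by positivity), div_mul_cancel₀ _ h0.ne'])
    rw [Real.sq_sqrt (by positivity), div_mul_eq_mul_div, div_le_iff₀ h0, mul_assoc] at h1
    exact le_of_mul_le_mul_left h1 hε

theorem response_fromCols {κ : Type*} [Fintype κ] (A : Matrix σ σ ℝ) (B : Matrix σ ι ℝ)
    (E : Matrix σ κ ℝ) (u : ℕ → ι ⊕ κ → ℝ) (k : ℕ) :
    response A (fromCols B E) u k =
      response A B (fun j => u j ∘ Sum.inl) k + response A E (fun j => u j ∘ Sum.inr) k := by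
  induction k with
  | zero => simp [response]
  | succ k ih =>
    simp only [response, ih, mulVec_add, fromCols_mulVec]
    abel

/-- Perturbing the state of a dissipative system by an `ℓ₂`-stable disturbance response costs
an arbitrarily small relative increase of the gain and a multiple of the disturbance energy. -/
theorem exists_disturbance_gain {κ : Type*} [Fintype κ] {E : Matrix σ κ ℝ} {H : ℝ} {γ : ℝ}
    (hγ : 0 ≤ γ)
    (hstable : ∀ T (e : ℕ → κ → ℝ), ∑ k ∈ Finset.range T, normSq (response A E e k) ≤
      H * ∑ k ∈ Finset.range T, normSq (e k))
    (h : ∀ L a, outputEnergy A B Cp L a ≤ γ * outputEnergy A B Cm L a) {θ : ℝ} (hθ : 0 < θ) :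
    ∃ M : ℝ, ∀ T (u : ℕ → ι ⊕ κ → ℝ),
      ∑ k ∈ Finset.range T, normSq (Cp *ᵥ response A (fromCols B E) u k) ≤
        (1 + θ) ^ 2 * γ * ∑ k ∈ Finset.range T, normSq (Cm *ᵥ response A (fromCols B E) u k) +
        M * ∑ k ∈ Finset.range T, normSq (u k ∘ Sum.inr) := by
  set cp := ∑ i, ∑ j, Cp i j ^ 2
  set cm := ∑ i, ∑ j, Cm i j ^ 2
  -- The state splits into an attack part and a disturbance part `xe`. The bracket collects the cost
  -- of removing `xe` from the performance output and of restoring it in the detection output; `H`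
  -- turns the energy of `xe` into that of the disturbance.
  refine ⟨((1 + θ) * γ * ((1 + θ⁻¹) * cm) + (1 + θ⁻¹) * cp) * H, fun T u => ?_⟩
  set xa := response A B fun j => u j ∘ Sum.inl with hxa
  set xe := response A E fun j => u j ∘ Sum.inr with hxe
  have hx : ∀ k, response A (fromCols B E) u k = xa k + xe k := response_fromCols A B E u
  have hcp : 0 ≤ cp := by positivity
  have hcm : 0 ≤ cm := by positivity
  have ha : ∑ k ∈ Finset.range T, normSq (Cp *ᵥ xa k) ≤
      γ * ∑ k ∈ Finset.range T, normSq (Cm *ᵥ xa k) := by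
    cases T with
    | zero => simp
    | succ L => simpa only [outputEnergy_eq_sum_range] using h L fun j => u j ∘ Sum.inl
  have he := hstable T fun j => u j ∘ Sum.inr
  simp only [hx]
  set Xe := ∑ k ∈ Finset.range T, normSq (xe k)
  have h1 : ∑ k ∈ Finset.range T, normSq (Cp *ᵥ (xa k + xe k)) ≤
      (1 + θ) * ∑ k ∈ Finset.range T, normSq (Cp *ᵥ xa k) + (1 + θ⁻¹) * (cp * Xe) := by
    simp only [Xe, Finset.mul_sum, ← Finset.sum_add_distrib]
    refine Finset.sum_le_sum fun k _ => ?_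
    rw [mulVec_add]
    refine (normSq_add_le _ _ hθ).trans ?_
    gcongr
    exact normSq_mulVec_le _ _
  have h2 : ∑ k ∈ Finset.range T, normSq (Cm *ᵥ xa k) ≤
      (1 + θ) * ∑ k ∈ Finset.range T, normSq (Cm *ᵥ (xa k + xe k)) +
        (1 + θ⁻¹) * (cm * Xe) := by
    simp only [Xe, Finset.mul_sum, ← Finset.sum_add_distrib]
    refine Finset.sum_le_sum fun k _ => ?_
    have h3 := normSq_add_le (Cm *ᵥ (xa k + xe k)) (-(Cm *ᵥ xe k)) hθ
    rw [← mulVec_neg, ← mulVec_add, add_neg_cancel_right, mulVec_neg,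
      rotationIdentity_normSq.map_neg] at h3
    refine h3.trans ?_
    gcongr
    exact normSq_mulVec_le _ _
  set Ye := ∑ k ∈ Finset.range T, normSq (u k ∘ Sum.inr)
  set Zm := ∑ k ∈ Finset.range T, normSq (Cm *ᵥ (xa k + xe k))
  calc _ ≤ _ := h1
    _ ≤ (1 + θ) * (γ * ((1 + θ) * Zm + (1 + θ⁻¹) * (cm * Xe))) + (1 + θ⁻¹) * (cp * Xe) := by
      have := ha.trans (mul_le_mul_of_nonneg_left h2 hγ)
      gcongr
    _ = (1 + θ) ^ 2 * γ * Zm + ((1 + θ) * γ * ((1 + θ⁻¹) * cm) + (1 + θ⁻¹) * cp) * Xe := by ring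
    _ ≤ (1 + θ) ^ 2 * γ * Zm +
        ((1 + θ) * γ * ((1 + θ⁻¹) * cm) + (1 + θ⁻¹) * cp) * (H * Ye) := by gcongr
    _ = _ := by ring

theorem rotationIdentity_supply {l κ : Type*} [Fintype κ] (Cp : Matrix o₁ σ ℝ) (Cm : Matrix o₂ σ ℝ)
    (γ M : ℝ) : RotationIdentity fun z : (σ → ℝ) × (l ⊕ κ → ℝ) =>
      γ * normSq (Cm *ᵥ z.1) - normSq (Cp *ᵥ z.1) + M * normSq (z.2 ∘ Sum.inr) := by
  intro p r x y
  have h1 := rotationIdentity_normSq p r (Cm *ᵥ x.1) (Cm *ᵥ y.1)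
  have h2 := rotationIdentity_normSq p r (Cp *ᵥ x.1) (Cp *ᵥ y.1)
  have h3 := rotationIdentity_normSq p r (x.2 ∘ Sum.inr) (y.2 ∘ Sum.inr)
  simp only [← mulVec_smul, ← mulVec_add, ← mulVec_sub] at h1 h2
  change normSq ((p • x + r • y).2 ∘ Sum.inr) + normSq ((r • x - p • y).2 ∘ Sum.inr) = _ at h3
  linear_combination γ * h1 - h2 + M * h3

/-- If the states not directly steered by the input are disturbed in an `ℓ₂`-stable way, there is
no duality gap between the security metric and its semidefinite program. -/
theorem metric_eq_sdpValue [DecidableEq σ] {E : Matrix σ σ ℝ} {F : Matrix ι σ ℝ}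
    (hE : E + B * F = 1) {H : ℝ}
    (hstable : ∀ T (e : ℕ → σ → ℝ), ∑ k ∈ Finset.range T, normSq (response A E e k) ≤
      H * ∑ k ∈ Finset.range T, normSq (e k)) {ε : ℝ} (hε : 0 < ε) :
    metric A B Cp Cm ε = sdpValue A B Cp Cm ε := by
  refine le_antisymm metric_le_sdpValue ?_
  rcases eq_or_ne (metric A B Cp Cm ε) ⊤ with htop | htop
  · rw [htop]
    exact le_top
  have hnn := metric_nonneg (A := A) (B := B) (Cp := Cp) (Cm := Cm) hε
  lift metric A B Cp Cm ε to ℝ using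
    ⟨htop, (lt_of_lt_of_le EReal.bot_lt_zero hnn).ne'⟩ with m hm
  have hm0 : 0 ≤ m := by exact_mod_cast hnn
  set γ := m / ε with hγ_def
  have hmγ : m = ε * γ := by rw [hγ_def]; field_simp
  have hγ : 0 ≤ γ := by positivity
  have hgain := outputEnergy_le_of_metric_le (γ := γ) hε (hm.ge.trans (by rw [hmγ]))
  have hfeas : ∀ θ > 0, sdpValue A B Cp Cm ε ≤ ((ε * ((1 + θ) ^ 2 * γ) : ℝ) : EReal) := by
    intro θ hθ
    obtain ⟨M, hM⟩ := exists_disturbance_gain hγ hstable hgain hθ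
    set γ' := (1 + θ) ^ 2 * γ
    obtain ⟨P, hP, hdiss⟩ := exists_storage_matrix (A := A) (W := fromCols B E)
      (rotationIdentity_supply Cp Cm γ' M)
      -- Attack `F x` with disturbance `x` gives `B F x + E x = x`.
      (fun x => ⟨Sum.elim (F *ᵥ x) x, by
        rw [fromCols_mulVec_sumElim, mulVec_mulVec, ← add_mulVec, add_comm, hE, one_mulVec]⟩)
      (fun T u => by
        have := hM T u
        simp only [supplied, Finset.sum_add_distrib, Finset.sum_sub_distrib, ← Finset.mul_sum]
        linarith)
    refine sInf_le ⟨γ', P, by positivity, hP, (neg_lmiMatrix_posSemidef_iff hP).2 fun x a => ?_, rfl⟩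
    -- Without disturbance the `M` term drops out and the inequality is the one required for `γ'`.
    have := hdiss x (Sum.elim a 0)
    simp only [fromCols_mulVec_sumElim, mulVec_zero, add_zero, Sum.elim_comp_inr,
      normSq_zero, mul_zero] at this
    linarith
  refine EReal.le_of_forall_lt_iff_le.1 fun z hz => ?_
  rw [EReal.coe_lt_coe_iff] at hz
  have hcont : Tendsto (fun θ : ℝ => ε * ((1 + θ) ^ 2 * γ)) (𝓝[>] 0) (𝓝 m) := by
    have : Continuous fun θ : ℝ => ε * ((1 + θ) ^ 2 * γ) := by fun_prop
    have := this.tendsto 0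
    simp only [add_zero, one_pow, one_mul, ← hmγ] at this
    exact this.mono_left nhdsWithin_le_nhds
  obtain ⟨θ, h1, h2⟩ := ((hcont.eventually (gt_mem_nhds hz)).and self_mem_nhdsWithin).exists
  exact (hfeas θ h2).trans (EReal.coe_le_coe_iff.2 h1.le)

end Duality

/-! ### `ℓ₂`-stability from convergence of matrix powers -/

section Stability

open scoped Matrix.Norms.Operator

variable {σ ι : Type*} [Fintype σ] [Fintype ι]

theorem response_eq_sum [DecidableEq σ] (A : Matrix σ σ ℝ) (B : Matrix σ ι ℝ) (a : ℕ → ι → ℝ) (k : ℕ) :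
    response A B a k = ∑ j ∈ Finset.range k, A ^ j *ᵥ (B *ᵥ a (k - 1 - j)) := by
  induction k with
  | zero => simp [response]
  | succ k ih =>
    rw [response, ih, Finset.sum_range_succ', mulVec_sum]
    simp only [mulVec_mulVec, pow_succ', pow_zero, Matrix.one_mul, Nat.add_sub_cancel,
      Nat.sub_zero, Matrix.mul_assoc]
    congr 1
    refine Finset.sum_congr rfl fun j _ => ?_
    rw [Nat.sub_sub, Nat.add_comm 1 j]

theorem sum_range_shift_le {ψ : ℕ → ℝ} (hψ : ∀ k, 0 ≤ ψ k) (T j : ℕ) :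
    ∑ k ∈ Finset.range T, (if j < k then ψ (k - 1 - j) else 0) ≤ ∑ k ∈ Finset.range T, ψ k := by
  have h : ∑ k ∈ Finset.range T, (if j < k then ψ (k - 1 - j) else 0) =
      ∑ k ∈ Finset.range (T - 1 - j), ψ k := by
    induction T with
    | zero => simp
    | succ T ih =>
      rw [Finset.sum_range_succ, ih]
      split_ifs with hj
      · rw [show T + 1 - 1 - j = T - 1 - j + 1 by omega, Finset.sum_range_succ]
      · rw [show T + 1 - 1 - j = T - 1 - j by omega, add_zero]
  rw [h]
  exact Finset.sum_le_sum_of_subset_of_nonneg (by gcongr; omega) fun k _ _ => hψ k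

/-- Young's inequality for causal convolutions. -/
theorem sum_sq_convolution_le {g φ : ℕ → ℝ} {b : ℝ} (hg : ∀ k, 0 ≤ g k)
    (hb : ∀ T, ∑ k ∈ Finset.range T, g k ≤ b) (T : ℕ) :
    ∑ k ∈ Finset.range T, (∑ j ∈ Finset.range k, g j * φ (k - 1 - j)) ^ 2 ≤
      b ^ 2 * ∑ k ∈ Finset.range T, φ k ^ 2 := by
  have hb0 : 0 ≤ b := by simpa using hb 0
  have h1 : ∀ k, (∑ j ∈ Finset.range k, g j * φ (k - 1 - j)) ^ 2 ≤
      b * ∑ j ∈ Finset.range k, g j * φ (k - 1 - j) ^ 2 := by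
    intro k
    -- Cauchy–Schwarz with weights `g`.
    refine (Finset.sum_sq_le_sum_mul_sum_of_sq_le_mul (Finset.range k)
      (f := g) (g := fun j => g j * φ (k - 1 - j) ^ 2) (fun j _ => hg j)
      (fun j _ => mul_nonneg (hg j) (sq_nonneg _)) fun j _ => le_of_eq (by ring)).trans ?_
    exact mul_le_mul_of_nonneg_right (hb k)
      (Finset.sum_nonneg fun j _ => mul_nonneg (hg j) (sq_nonneg _))
  have h2 : ∑ k ∈ Finset.range T, ∑ j ∈ Finset.range k, g j * φ (k - 1 - j) ^ 2 =
      ∑ j ∈ Finset.range T, g j *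
        ∑ k ∈ Finset.range T, if j < k then φ (k - 1 - j) ^ 2 else 0 := by
    simp only [Finset.mul_sum, mul_ite, mul_zero]
    rw [Finset.sum_comm (s := Finset.range T) (t := Finset.range T)]
    refine Finset.sum_congr rfl fun k hk => ?_
    rw [← Finset.sum_filter]
    refine Finset.sum_congr ?_ fun _ _ => rfl
    ext j
    simp only [Finset.mem_filter, Finset.mem_range] at hk ⊢
    omega
  calc _ ≤ ∑ k ∈ Finset.range T, b * ∑ j ∈ Finset.range k, g j * φ (k - 1 - j) ^ 2 :=
        Finset.sum_le_sum fun k _ => h1 k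
    _ = b * ∑ j ∈ Finset.range T, g j *
        ∑ k ∈ Finset.range T, if j < k then φ (k - 1 - j) ^ 2 else 0 := by
      rw [← Finset.mul_sum, h2]
    _ ≤ b * ∑ j ∈ Finset.range T, g j * ∑ k ∈ Finset.range T, φ k ^ 2 := by
      refine mul_le_mul_of_nonneg_left (Finset.sum_le_sum fun j _ => ?_) hb0
      exact mul_le_mul_of_nonneg_left
        (sum_range_shift_le (ψ := fun k => φ k ^ 2) (fun k => sq_nonneg _) T j) (hg j)
    _ ≤ b * (b * ∑ k ∈ Finset.range T, φ k ^ 2) := by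
      rw [← Finset.sum_mul]
      gcongr
      exact hb T
    _ = _ := by ring

/-- Once `‖M ^ m‖ < 1/2`, the partial sums satisfy `s_T ≤ s_m + s_T / 2`, so they are at most `2
s_m`. -/
theorem exists_sum_norm_pow_le [DecidableEq σ] {M : Matrix σ σ ℝ}
    (hM : ∀ v, Tendsto (fun k => M ^ k *ᵥ v) atTop (𝓝 0)) :
    ∃ b, ∀ T, ∑ k ∈ Finset.range T, ‖M ^ k‖ ≤ b := by
  have h0 : Tendsto (fun k => M ^ k) atTop (𝓝 0) := by
    refine tendsto_pi_nhds.2 fun i => tendsto_pi_nhds.2 fun j => ?_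
    have := tendsto_pi_nhds.1 (hM (Pi.single j 1)) i
    simpa using this
  obtain ⟨m, hm⟩ := ((tendsto_norm_zero.comp h0).eventually
    (gt_mem_nhds (show (0 : ℝ) < 1 / 2 by norm_num))).exists
  simp only [Function.comp_apply] at hm
  refine ⟨2 * ∑ k ∈ Finset.range m, ‖M ^ k‖, fun T => ?_⟩
  have h1 : ∑ k ∈ Finset.range T, ‖M ^ k‖ ≤ ∑ k ∈ Finset.range (m + T), ‖M ^ k‖ :=
    Finset.sum_le_sum_of_subset_of_nonneg (by gcongr; omega) fun _ _ _ => norm_nonneg _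
  have h2 : ∑ k ∈ Finset.range T, ‖M ^ (m + k)‖ ≤
      1 / 2 * ∑ k ∈ Finset.range T, ‖M ^ k‖ := by
    rw [Finset.mul_sum]
    refine Finset.sum_le_sum fun k _ => ?_
    rw [pow_add]
    exact (norm_mul_le _ _).trans (mul_le_mul_of_nonneg_right hm.le (norm_nonneg _))
  rw [Finset.sum_range_add] at h1
  linarith

theorem normSq_le_card_mul_norm_sq (v : σ → ℝ) : normSq v ≤ Fintype.card σ * ‖v‖ ^ 2 := by
  rw [← nsmul_eq_mul, ← Finset.card_univ]
  refine Finset.sum_le_card_nsmul _ _ _ fun i _ => ?_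
  rw [← sq_abs]
  have := norm_le_pi_norm v i
  rw [Real.norm_eq_abs] at this
  gcongr

theorem norm_sq_le_normSq (v : σ → ℝ) : ‖v‖ ^ 2 ≤ normSq v := by
  rw [← Real.le_sqrt (norm_nonneg _) (normSq_nonneg _),
    pi_norm_le_iff_of_nonneg (Real.sqrt_nonneg _)]
  intro i
  rw [Real.norm_eq_abs]
  exact Real.abs_le_sqrt
    (Finset.single_le_sum (f := fun i => v i ^ 2) (fun j _ => sq_nonneg _) (Finset.mem_univ i))

theorem exists_energy_bound [DecidableEq σ] {M : Matrix σ σ ℝ}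
    (hM : ∀ v, Tendsto (fun k => M ^ k *ᵥ v) atTop (𝓝 0)) :
    ∃ H, 0 ≤ H ∧ ∀ T (f : ℕ → σ → ℝ), ∑ k ∈ Finset.range T, normSq (response M 1 f k) ≤
      H * ∑ k ∈ Finset.range T, normSq (f k) := by
  obtain ⟨b, hb⟩ := exists_sum_norm_pow_le hM
  refine ⟨Fintype.card σ * b ^ 2, by positivity, fun T f => ?_⟩
  have h1 : ∀ k, ‖response M 1 f k‖ ≤ ∑ j ∈ Finset.range k, ‖M ^ j‖ * ‖f (k - 1 - j)‖ := by
    intro k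
    rw [response_eq_sum]
    refine (norm_sum_le _ _).trans (Finset.sum_le_sum fun j _ => ?_)
    rw [one_mulVec]
    exact linfty_opNorm_mulVec _ _
  calc _ ≤ ∑ k ∈ Finset.range T, Fintype.card σ *
        (∑ j ∈ Finset.range k, ‖M ^ j‖ * ‖f (k - 1 - j)‖) ^ 2 := by
        refine Finset.sum_le_sum fun k _ => (normSq_le_card_mul_norm_sq _).trans ?_
        gcongr
        exact h1 k
    _ ≤ Fintype.card σ * (b ^ 2 * ∑ k ∈ Finset.range T, ‖f k‖ ^ 2) := by
      rw [← Finset.mul_sum]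
      gcongr
      exact sum_sq_convolution_le (φ := fun k => ‖f k‖) (fun _ => norm_nonneg _) hb T
    _ ≤ Fintype.card σ * (b ^ 2 * ∑ k ∈ Finset.range T, normSq (f k)) := by
      gcongr
      exact norm_sq_le_normSq _
    _ = _ := by ring

/-- If the dynamics converges on the kernel of an output `S` that it preserves, then disturbances
in that kernel have an `ℓ₂`-bounded effect. -/
theorem exists_energy_bound_of_ker [DecidableEq σ] [DecidableEq ι] {A : Matrix σ σ ℝ} {B : Matrix σ ι ℝ} {S : Matrix ι σ ℝ}
    (hSA : S * A = S) (hSB : S * B = 1)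
    (hA : ∀ v, S *ᵥ v = 0 → Tendsto (fun k => A ^ k *ᵥ v) atTop (𝓝 0)) :
    ∃ H, 0 ≤ H ∧ ∀ T (f : ℕ → σ → ℝ), (∀ k, S *ᵥ f k = 0) →
      ∑ k ∈ Finset.range T, normSq (response A 1 f k) ≤
        H * ∑ k ∈ Finset.range T, normSq (f k) := by
  -- `1 - B * S` projects onto the kernel of `S`. So `M` agrees with `A` there, and maps every
  -- vector into it, which makes its powers tend to zero everywhere.
  set M := A * (1 - B * S) with hM_def
  have hMv : ∀ v, S *ᵥ v = 0 → M *ᵥ v = A *ᵥ v := by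
    intro v hv
    rw [hM_def, ← mulVec_mulVec, sub_mulVec, ← mulVec_mulVec, hv]
    simp
  have hSM : S * M = 0 := by
    rw [hM_def, ← Matrix.mul_assoc, hSA, Matrix.mul_sub, ← Matrix.mul_assoc, hSB]
    simp
  have hSAv : ∀ v, S *ᵥ (A *ᵥ v) = S *ᵥ v := fun v => by rw [mulVec_mulVec, hSA]
  have hpow : ∀ v, S *ᵥ v = 0 → ∀ k, S *ᵥ (A ^ k *ᵥ v) = 0 ∧ M ^ k *ᵥ v = A ^ k *ᵥ v := by
    intro v hv k
    induction k with
    | zero => simpa using hv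
    | succ k ih =>
      rw [pow_succ', pow_succ', ← mulVec_mulVec, ← mulVec_mulVec, hSAv, ih.2, hMv _ ih.1]
      exact ⟨ih.1, rfl⟩
  obtain ⟨H, hH, h⟩ := exists_energy_bound (M := M) (fun v => by
    rw [← tendsto_add_atTop_iff_nat 1]
    have hv : S *ᵥ (M *ᵥ v) = 0 := by rw [mulVec_mulVec, hSM, zero_mulVec]
    refine (hA _ hv).congr fun k => ?_
    rw [pow_succ, ← (hpow _ hv k).2, mulVec_mulVec])
  refine ⟨H, hH, fun T f hf => ?_⟩
  have hresp : ∀ k, S *ᵥ response A 1 f k = 0 ∧ response M 1 f k = response A 1 f k := by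
    intro k
    induction k with
    | zero => simp [response]
    | succ k ih =>
      rw [response, response, ih.2, hMv _ ih.1, mulVec_add, hSAv, ih.1, one_mulVec, hf]
      simp
  simpa only [(hresp _).2] using h T f

end Stability

/-! ### Stability of the system with delayed copies -/

section DelayedStability

variable {σ ι : Type*} [Fintype σ] [Fintype ι]

/-- The `i`-th delayed copy of the state. -/
def block {d : ℕ} (i : Fin (d + 1)) (x : Fin (d + 1) × σ → ℝ) : σ → ℝ := fun p => x (i, p)

theorem normSq_eq_sum_block {d : ℕ} (x : Fin (d + 1) × σ → ℝ) :
    normSq x = ∑ i, normSq (block i x) := by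
  simp only [normSq, Fintype.sum_prod_type, block]

theorem normSq_block_le {d : ℕ} (i : Fin (d + 1)) (x : Fin (d + 1) × σ → ℝ) :
    normSq (block i x) ≤ normSq x := by
  rw [normSq_eq_sum_block]
  exact Finset.single_le_sum (f := fun i => normSq (block i x))
    (fun _ _ => normSq_nonneg _) (Finset.mem_univ i)

theorem block_zero_Atilde_mulVec [DecidableEq σ] (d : ℕ) (A : Matrix σ σ ℝ) (x : Fin (d + 1) × σ → ℝ) :
    block 0 (Atilde d A *ᵥ x) = A *ᵥ block 0 x := by
  ext p
  simp [block, mulVec, dotProduct, Atilde, Fintype.sum_prod_type]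

theorem block_succ_Atilde_mulVec [DecidableEq σ] (d : ℕ) (A : Matrix σ σ ℝ) (x : Fin (d + 1) × σ → ℝ)
    (i : Fin d) : block i.succ (Atilde d A *ᵥ x) = block i.castSucc x := by
  ext p
  simp only [block, mulVec, dotProduct, Atilde, of_apply, Fin.val_succ, Nat.succ_ne_zero, if_false,
    Fintype.sum_prod_type, add_left_inj, ite_mul, one_mul, zero_mul]
  rw [Finset.sum_eq_single i.castSucc, Finset.sum_eq_single p]
  · simp
  · intro q _ hq
    simp [hq.symm]
  · simp
  · intro j _ hj
    refine Finset.sum_eq_zero fun q _ => if_neg fun h => hj (Fin.ext ?_)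
    simpa using h.1.symm
  · simp

theorem block_zero_Btilde_mulVec {σ : Type*} (d : ℕ) (B : Matrix σ ι ℝ) (v : ι → ℝ) :
    block 0 (Btilde d B *ᵥ v) = B *ᵥ v := by
  ext p
  simp [block, mulVec, dotProduct, Btilde]

theorem Ccurrent_mulVec {o : Type*} (d : ℕ) (C : Matrix o σ ℝ) (x : Fin (d + 1) × σ → ℝ) :
    Ccurrent d C *ᵥ x = C *ᵥ block 0 x := by
  ext p
  simp [block, mulVec, dotProduct, Ccurrent, Fintype.sum_prod_type]

/-- `E` sends the current block into the kernel of `S`, where the undelayed bound applies. Each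
further block is the preceding one a step later plus a disturbance, so the bound passes along the
delay chain by induction. -/
theorem exists_energy_bound_delayed [DecidableEq σ] [DecidableEq ι] (d : ℕ) {A : Matrix σ σ ℝ} {B : Matrix σ ι ℝ}
    {S : Matrix ι σ ℝ} (hSA : S * A = S) (hSB : S * B = 1)
    (hA : ∀ v, S *ᵥ v = 0 → Tendsto (fun k => A ^ k *ᵥ v) atTop (𝓝 0)) :
    ∃ H, ∀ T (e : ℕ → Fin (d + 1) × σ → ℝ),
      ∑ k ∈ Finset.range T,
          normSq (response (Atilde d A) (1 - Btilde d B * Ccurrent d S) e k) ≤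
        H * ∑ k ∈ Finset.range T, normSq (e k) := by
  obtain ⟨H₀, hH₀, h⟩ := exists_energy_bound_of_ker hSA hSB hA
  set E := 1 - Btilde d B * Ccurrent d S with hE
  set c := ∑ i, ∑ j, E i j ^ 2
  have hc : 0 ≤ c := by positivity
  have hker : ∀ v, S *ᵥ block 0 (E *ᵥ v) = 0 := by
    intro v
    have : block 0 (E *ᵥ v) = block 0 v - B *ᵥ (S *ᵥ block 0 v) := by
      rw [hE, sub_mulVec, one_mulVec, ← mulVec_mulVec, Ccurrent_mulVec,
        ← block_zero_Btilde_mulVec d B]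
      rfl
    rw [this, mulVec_sub, mulVec_mulVec, hSB, one_mulVec, sub_self]
  have hstep : ∀ (e : ℕ → Fin (d + 1) × σ → ℝ) (i : Fin (d + 1)) (k : ℕ),
      block i (response (Atilde d A) E e (k + 1)) =
        block i (Atilde d A *ᵥ response (Atilde d A) E e k) + block i (E *ᵥ e k) :=
    fun _ _ _ => rfl
  have hzero : ∀ (e : ℕ → Fin (d + 1) × σ → ℝ) k,
      block 0 (response (Atilde d A) E e k) = response A 1 (fun j => block 0 (E *ᵥ e j)) k := by
    intro e k
    induction k with
    | zero => rfl
    | succ k ih => rw [hstep, block_zero_Atilde_mulVec, ih, response, one_mulVec]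
  have hdist : ∀ T (e : ℕ → Fin (d + 1) × σ → ℝ) i,
      ∑ k ∈ Finset.range T, normSq (block i (E *ᵥ e k)) ≤
        c * ∑ k ∈ Finset.range T, normSq (e k) := by
    intro T e i
    rw [Finset.mul_sum]
    exact Finset.sum_le_sum fun k _ => (normSq_block_le _ _).trans (normSq_mulVec_le _ _)
  have hblock : ∀ i : Fin (d + 1), ∃ H, ∀ T (e : ℕ → Fin (d + 1) × σ → ℝ),
      ∑ k ∈ Finset.range T, normSq (block i (response (Atilde d A) E e k)) ≤
        H * ∑ k ∈ Finset.range T, normSq (e k) := by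
    intro i
    induction i using Fin.induction with
    | zero =>
      refine ⟨H₀ * c, fun T e => ?_⟩
      simp only [hzero, mul_assoc]
      exact (h T _ fun k => hker _).trans (mul_le_mul_of_nonneg_left (hdist T e 0) hH₀)
    | succ i ih =>
      obtain ⟨H, ih⟩ := ih
      refine ⟨2 * H + 2 * c, fun T e => ?_⟩
      have h0 : block i.succ (response (Atilde d A) E e 0) = 0 := rfl
      -- One extra step is added so that dropping the zero initial term leaves `T` shifted ones.
      calc _ ≤ ∑ k ∈ Finset.range (T + 1),
            normSq (block i.succ (response (Atilde d A) E e k)) :=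
            Finset.sum_le_sum_of_subset_of_nonneg (by gcongr; omega)
              fun _ _ _ => normSq_nonneg _
        _ ≤ ∑ k ∈ Finset.range T, (2 * normSq (block i.castSucc (response (Atilde d A) E e k)) +
            2 * normSq (block i.succ (E *ᵥ e k))) := by
          rw [Finset.sum_range_succ', h0, normSq_zero, add_zero]
          refine Finset.sum_le_sum fun k _ => ?_
          rw [hstep, block_succ_Atilde_mulVec]
          refine (normSq_add_le _ _ one_pos).trans_eq ?_
          norm_num
        _ ≤ _ := by
          rw [Finset.sum_add_distrib, ← Finset.mul_sum, ← Finset.mul_sum]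
          linarith [ih T e, hdist T e i.succ]
  choose Hb hHb using hblock
  refine ⟨∑ i, Hb i, fun T e => ?_⟩
  simp only [normSq_eq_sum_block (response _ _ _ _)]
  rw [Finset.sum_comm, Finset.sum_mul]
  exact Finset.sum_le_sum fun i _ => hHb i T e

end DelayedStability

/-! ### Convergence of the network on zero dual sum -/

section Network

variable {N n : ℕ}

/-- The sum of the dual variables `z_i` over all agents. -/
def dualSum (N n : ℕ) : Matrix (Fin n) (State N n) ℝ :=
  Matrix.of fun s p => Sum.elim (fun _ => 0) (fun r : Fin N × Fin n => if r.2 = s then 1 else 0) p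

theorem dualSum_mulVec (y : State N n → ℝ) (s : Fin n) :
    (dualSum N n *ᵥ y) s = ∑ i, y (Sum.inr (i, s)) := by
  simp [mulVec, dotProduct, dualSum, Fintype.sum_prod_type]

theorem stackK_mulVec (K : Matrix (Fin N) (Fin N) ℝ) (y : Fin N × Fin n → ℝ) (i : Fin N)
    (s : Fin n) : (stackK n K *ᵥ y) (i, s) = (K *ᵥ fun j => y (j, s)) i := by
  simp [mulVec, dotProduct, stackK, Fintype.sum_prod_type]

theorem dualSum_mul_Bbar (va : Fin N) : dualSum N n * Bbar n va = 1 := by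
  refine ext_of_mulVec_single fun t => ?_
  ext s
  rw [← mulVec_mulVec, dualSum_mulVec]
  simp [Bbar, Matrix.one_apply, Prod.ext_iff, ite_and]

theorem Abar_mulVec_inr (K : Matrix (Fin N) (Fin N) ℝ) (Q : Fin N → Matrix (Fin n) (Fin n) ℝ)
    (α : ℝ) (y : State N n → ℝ) :
    (Abar K Q α *ᵥ y) ∘ Sum.inr = stackK n K *ᵥ (y ∘ Sum.inl) + y ∘ Sum.inr := by
  rw [Abar, fromBlocks_mulVec, Sum.elim_comp_inr, one_mulVec]

theorem Abar_mulVec_inl (K : Matrix (Fin N) (Fin N) ℝ) (Q : Fin N → Matrix (Fin n) (Fin n) ℝ)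
    (α : ℝ) (y : State N n → ℝ) :
    (Abar K Q α *ᵥ y) ∘ Sum.inl =
      (1 - stackK n K - α • stackQ Q) *ᵥ (y ∘ Sum.inl) - stackK n K *ᵥ (y ∘ Sum.inr) := by
  rw [Abar, fromBlocks_mulVec, Sum.elim_comp_inl, neg_mulVec, sub_eq_add_neg _ (stackK n K *ᵥ _)]

theorem sum_mulVec_eq_zero {K : Matrix (Fin N) (Fin N) ℝ} (hK : ∀ j, ∑ i, K i j = 0)
    (v : Fin N → ℝ) : ∑ i, (K *ᵥ v) i = 0 := by
  simp only [mulVec, dotProduct]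
  rw [Finset.sum_comm]
  simp [← Finset.sum_mul, hK]

theorem dualSum_mul_Abar {K : Matrix (Fin N) (Fin N) ℝ} (hK : ∀ j, ∑ i, K i j = 0)
    (Q : Fin N → Matrix (Fin n) (Fin n) ℝ) (α : ℝ) : dualSum N n * Abar K Q α = dualSum N n := by
  refine ext_of_mulVec_single fun t => ?_
  ext s
  generalize (Pi.single t 1 : State N n → ℝ) = y
  rw [← mulVec_mulVec, dualSum_mulVec, dualSum_mulVec]
  have h : ∀ i, (Abar K Q α *ᵥ y) (Sum.inr (i, s)) =
      (K *ᵥ fun j => y (Sum.inl (j, s))) i + y (Sum.inr (i, s)) := by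
    intro i
    have := congrFun (Abar_mulVec_inr K Q α y) (i, s)
    rw [Pi.add_apply, stackK_mulVec] at this
    exact this
  simp only [h, Finset.sum_add_distrib, sum_mulVec_eq_zero hK, zero_add]

/-- Because rows and columns of `K` sum to zero, `∑ K i j (v i - v j)²` equals `-2 vᵀ K v = 0`. Its
terms are nonpositive, so `v` is constant across edges, hence along walks. -/
theorem IsWeightMatrix.eq_of_mulVec_eq_zero {G : SimpleGraph (Fin N)} (hG : G.Connected)
    {K : Matrix (Fin N) (Fin N) ℝ} (hK : IsWeightMatrix G K) {v : Fin N → ℝ}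
    (hv : K *ᵥ v = 0) (i j : Fin N) : v i = v j := by
  have hrow : ∀ i, ∑ j, K i j = 0 := fun i => by
    simpa only [hK.symm.apply] using hK.col_sum i
  have hsum : ∑ i, ∑ j, K i j * (v i - v j) ^ 2 = 0 := by
    have h1 : ∑ i, ∑ j, K i j * v i ^ 2 = 0 := by simp [← Finset.sum_mul, hrow]
    have h2 : ∑ i, ∑ j, K i j * v j ^ 2 = 0 := by
      rw [Finset.sum_comm]
      simp [← Finset.sum_mul, hK.col_sum]
    have h3 : ∑ i, ∑ j, K i j * (v i * v j) = 0 := by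
      have : ∀ i, ∑ j, K i j * (v i * v j) = v i * (K *ᵥ v) i := fun i => by
        rw [mulVec, dotProduct, Finset.mul_sum]
        exact Finset.sum_congr rfl fun j _ => by ring
      simp [this, hv]
    calc _ = ∑ i, ∑ j, K i j * v i ^ 2 + ∑ i, ∑ j, K i j * v j ^ 2
          - 2 * ∑ i, ∑ j, K i j * (v i * v j) := by
          simp only [Finset.mul_sum, ← Finset.sum_add_distrib, ← Finset.sum_sub_distrib]
          exact Finset.sum_congr rfl fun i _ => Finset.sum_congr rfl fun j _ => by ring
      _ = 0 := by rw [h1, h2, h3]; ring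
  have hterm : ∀ i j, K i j * (v i - v j) ^ 2 ≤ 0 := by
    intro i j
    rcases eq_or_ne i j with rfl | hij
    · simp
    · by_cases hadj : G.Adj i j
      · exact mul_nonpos_of_nonpos_of_nonneg (hK.adj i j hadj).le (sq_nonneg _)
      · simp [hK.not_adj i j hij hadj]
  have hadj : ∀ i j, G.Adj i j → v i = v j := by
    intro i j hij
    have h1 := (Finset.sum_eq_zero_iff_of_nonpos
      (fun i _ => Finset.sum_nonpos fun j _ => hterm i j)).1 hsum i (Finset.mem_univ i)
    have h2 := (Finset.sum_eq_zero_iff_of_nonpos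
      (fun j _ => hterm i j)).1 h1 j (Finset.mem_univ j)
    rw [mul_eq_zero, or_iff_right (hK.adj i j hij).ne, sq_eq_zero_iff, sub_eq_zero] at h2
    exact h2
  obtain ⟨p⟩ := hG.preconnected i j
  induction p with
  | nil => rfl
  | cons h _ ih => exact (hadj _ _ h).trans ih

/-- A vector with zero sum is recovered from its image under the weight matrix. -/
theorem IsWeightMatrix.exists_left_inverse {G : SimpleGraph (Fin N)} (hG : G.Connected)
    {K : Matrix (Fin N) (Fin N) ℝ} (hK : IsWeightMatrix G K) :
    ∃ R : Matrix (Fin N) (Fin N) ℝ, ∀ v : Fin N → ℝ, ∑ i, v i = 0 → R *ᵥ (K *ᵥ v) = v := by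
  -- Adding the all-ones matrix makes `K` invertible without changing it on zero-sum vectors.
  set J : Matrix (Fin N) (Fin N) ℝ := Matrix.of fun _ _ => 1
  have hJ : ∀ v i, (J *ᵥ v) i = ∑ j, v j := fun v i => by simp [J, mulVec, dotProduct]
  have hinj : Function.Injective (K + J).mulVec := by
    rw [← coe_mulVecLin, injective_iff_map_eq_zero]
    intro v hv
    rw [mulVecLin_apply, add_mulVec] at hv
    have hN : (0 : ℝ) < N := by
      have := hG.nonempty
      exact_mod_cast Fin.pos_iff_nonempty.2 this
    have hs : ∑ j, v j = 0 := by
      have h1 : ∑ i, (K *ᵥ v + J *ᵥ v) i = 0 := by rw [hv]; simp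
      simp only [Pi.add_apply, Finset.sum_add_distrib, sum_mulVec_eq_zero hK.col_sum, hJ,
        Finset.sum_const, Finset.card_univ, Fintype.card_fin, zero_add, nsmul_eq_mul] at h1
      exact (mul_eq_zero.1 h1).resolve_left hN.ne'
    have hKv : K *ᵥ v = 0 := by
      have h2 : J *ᵥ v = 0 := by ext i; rw [hJ, hs]; rfl
      rwa [h2, add_zero] at hv
    ext i
    have h3 : ∑ j, v j = N * v i := by
      rw [Finset.sum_congr rfl fun j _ => hK.eq_of_mulVec_eq_zero hG hKv j i]
      simp
    rw [hs] at h3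
    exact (mul_eq_zero.1 h3.symm).resolve_left hN.ne'
  have hunit : IsUnit (K + J) := mulVec_injective_iff_isUnit.1 hinj
  refine ⟨(K + J)⁻¹, fun v hv => ?_⟩
  have h1 : K *ᵥ v = (K + J) *ᵥ v := by
    rw [add_mulVec, left_eq_add]
    ext i
    rw [hJ, hv]
    rfl
  rw [h1, mulVec_mulVec, nonsing_inv_mul _ ((isUnit_iff_isUnit_det _).1 hunit), one_mulVec]

theorem nominal_sub_nominal (K : Matrix (Fin N) (Fin N) ℝ)
    (Q : Fin N → Matrix (Fin n) (Fin n) ℝ) (c : Fin N → Fin n → ℝ) (α : ℝ)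
    (y y' : State N n → ℝ) (k : ℕ) :
    nominal K Q c α y k - nominal K Q c α y' k = Abar K Q α ^ k *ᵥ (y - y') := by
  induction k with
  | zero => simp [nominal]
  | succ k ih => rw [nominal, nominal, add_sub_add_right_eq_sub, ← mulVec_sub, ih, mulVec_mulVec,
      pow_succ']

/-- `Ā ^ k v` is the difference of two nominal runs, whose estimates share one limit, so its `x`
part vanishes. The `x` update then forces `K z → 0`, and on the conserved zero-sum space `z` is
recovered from `K z`. -/
theorem tendsto_Abar_pow_mulVec {G : SimpleGraph (Fin N)} (hG : G.Connected)
    {K : Matrix (Fin N) (Fin N) ℝ} (hK : IsWeightMatrix G K)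
    {Q : Fin N → Matrix (Fin n) (Fin n) ℝ} {c : Fin N → Fin n → ℝ} {α : ℝ}
    (hα : IsAdmissibleStep K Q c α) {v : State N n → ℝ} (hv : dualSum N n *ᵥ v = 0) :
    Tendsto (fun k => Abar K Q α ^ k *ᵥ v) atTop (𝓝 0) := by
  obtain ⟨-, xstar, -, hx⟩ := hα
  set y : ℕ → State N n → ℝ := fun k => Abar K Q α ^ k *ᵥ v with hy
  have hinl : Tendsto (fun k => y k ∘ Sum.inl) atTop (𝓝 0) := by
    refine tendsto_pi_nhds.2 fun ⟨i, s⟩ => ?_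
    have h1 := (tendsto_pi_nhds.1 (hx v i) s).sub (tendsto_pi_nhds.1 (hx 0 i) s)
    rw [sub_self] at h1
    refine h1.congr fun k => ?_
    have h2 := congrFun (nominal_sub_nominal K Q c α v 0 k) (Sum.inl (i, s))
    rw [sub_zero] at h2
    exact h2
  have hstep : ∀ k, y (k + 1) = Abar K Q α *ᵥ y k := fun k => by
    simp only [hy, pow_succ', ← mulVec_mulVec]
  have hKz : Tendsto (fun k => stackK n K *ᵥ (y k ∘ Sum.inr)) atTop (𝓝 0) := by
    have hcont : Continuous fun u : Fin N × Fin n → ℝ =>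
        (1 - stackK n K - α • stackQ Q) *ᵥ u := by fun_prop
    have h1 := ((hcont.tendsto 0).comp hinl).sub ((tendsto_add_atTop_iff_nat 1).2 hinl)
    rw [mulVec_zero, sub_zero] at h1
    refine h1.congr fun k => ?_
    rw [Function.comp_apply, hstep, Abar_mulVec_inl, sub_sub_cancel]
  have hS : ∀ k, dualSum N n *ᵥ y k = 0 := by
    intro k
    induction k with
    | zero => simpa [hy] using hv
    | succ k ih => rw [hstep, mulVec_mulVec, dualSum_mul_Abar hK.col_sum, ih]
  obtain ⟨R, hR⟩ := hK.exists_left_inverse hG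
  refine tendsto_pi_nhds.2 ?_
  rintro (r | ⟨i, s⟩)
  · exact tendsto_pi_nhds.1 hinl r
  · have hKs : Tendsto (fun k => K *ᵥ fun j => y k (Sum.inr (j, s))) atTop (𝓝 0) := by
      refine tendsto_pi_nhds.2 fun j => ?_
      refine (tendsto_pi_nhds.1 hKz (j, s)).congr fun k => ?_
      rw [stackK_mulVec]
      rfl
    have hcont : Continuous fun u : Fin N → ℝ => R *ᵥ u := by fun_prop
    have h1 := tendsto_pi_nhds.1 ((hcont.tendsto 0).comp hKs) i
    rw [mulVec_zero] at h1
    refine h1.congr fun k => ?_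
    have h2 := congrFun (hS k) s
    rw [dualSum_mulVec] at h2
    exact congrFun (hR _ h2) i

end Network

end WangElia

end

theorem theorem2 {N n : ℕ} (G : SimpleGraph (Fin N)) (hG : G.Connected)
    (K : Matrix (Fin N) (Fin N) ℝ) (hK : WangElia.IsWeightMatrix G K)
    (Q : Fin N → Matrix (Fin n) (Fin n) ℝ) (hQ : ∀ i, (Q i).PosSemidef)
    (c : Fin N → Fin n → ℝ) (α : ℝ) (hα : WangElia.IsAdmissibleStep K Q c α)
    (w : Fin n → ℝ) (hw : ∀ s, w s ∈ Set.Icc (0 : ℝ) 1)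
    (va vm : Fin N) (ε : ℝ) (hε : 0 < ε)
    (d : ℕ) (hd : d = WangElia.delay K Q α w va vm) :
    WangElia.metric
        (WangElia.Atilde d (WangElia.Abar K Q α)) (WangElia.Btilde d (WangElia.Bbar n va))
        (WangElia.Cdelayed d (WangElia.Cpbar N n)) (WangElia.Ccurrent d (WangElia.Cmbar vm w)) ε =
      WangElia.sdpValue
        (WangElia.Atilde d (WangElia.Abar K Q α)) (WangElia.Btilde d (WangElia.Bbar n va))
        (WangElia.Cdelayed d (WangElia.Cpbar N n)) (WangElia.Ccurrent d (WangElia.Cmbar vm w)) ε := by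
  obtain ⟨H, hH⟩ := WangElia.exists_energy_bound_delayed d
    (WangElia.dualSum_mul_Abar (n := n) hK.col_sum Q α) (WangElia.dualSum_mul_Bbar va)
    fun v hv => WangElia.tendsto_Abar_pow_mulVec hG hK hα hv
  -- Here `E = 1 - B̃ S̃` and `F = S̃`.
  exact WangElia.metric_eq_sdpValue (sub_add_cancel _ _) hH hε
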